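/- **Setting.** Let $\mathcal O$ be a Dedekind domain, $\mathfrak p$ a nonzero prime ideal with finite residue field of cardinality $q$, and $\pi$ a generator of $\mathfrak p\mathcal O_{\mathfrak p}$. Let $R$ be an $\mathcal O_{\mathfrak p}$-algebra that is a $\pi$-adically complete discrete valuation ring in which $\pi\neq 0$, and let $\phi:R\to R$ be an $\mathcal O_{\mathfrak p}$-algebra endomorphism with $\phi(x)\equiv x^q \bmod \pi$ for all $x\in R$. For an $R$-algebra $B$ let $W_n(B)$ be the ring of $\pi$-typical Witt vectors of length $n+1$ (with ghost components $w_i=\sum_{j\le i}\pi^jx_j^{q^{i-j}}$), $F:W_{n+1}(B)\to W_n(B)$ its Frobenius, and $\exp_\delta:R\to W_n(R)$ the ring homomorphism such that $\exp_\delta(r)$ has ghost components $(r,\phi(r),\phi^2(r),\dots)$. For $m,n\ge 0$ let $$W_{[m]n}(B)=W_m(R)\times_{W_m(B)}W_{m+n}(B),$$ an $R$-algebra via $\exp_\delta$. Write $B^{\phi}$ (or $R^\phi\to B^\phi$) for $R\to B$ with both $R$-algebra structures precomposed with $\phi$; in $W_{[m]n}(B^{\phi})$ the ring $R$ is thus replaced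 by $R^\phi$. There are ring homomorphisms, functorial in $B$ and compatible with the $R$-algebra structures: * the lateral Frobenius $F_{[m]}:W_{[m]n}(B)\to W_{[m]n-1}(B^\phi)$ ($m\ge 0$, $n\ge1$), which on ghost components is $\langle z_0,\dots,z_{m+n}\rangle\mapsto\langle\phi(z_0),\dots,\phi(z_m),z_{m+2},\dots,z_{m+n}\rangle$; * $E_{[m]}:W_{[m]n}(B)\to W_{[m-1]n}(B^\phi)$ ($m\ge1$, $n\ge 0$), induced by $F$ on both factors, which on ghost components is $\langle z_0,\dots,z_{m+n}\rangle\mapsto\langle z_1,\dots,z_{m+n}\rangle$. Let $X$ be a $\pi$-formal scheme over $S=\operatorname{Spf}R$ with a marked point $P\in X(R)$, and let $P^m:\operatorname{Spf}W_m(R)\to\operatorname{Spf}R\to X$ be the composite of the morphism induced by $\exp_\delta$ with $P$. Let $N^{[m]n}X$ be the kernel of $J^{m+n}X\to J^mX$ over the point $P^m$, that is, the functor on $\pi$-adically complete $R$-algebras $$N^{[m]n}X(B)=\{\,g\in X(W_{[m]n}(B)) : g\circ i_m=P^m\,\},$$ where $X(W_{[m]n}(B))$ is the set of $S$-morphisms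 $\operatorname{Spf} W_{[m]n}(B)\to X$ and $i_m:\operatorname{Spf}W_m(R)\to\operatorname{Spf}W_{[m]n}(B)$ is induced by the projection to $W_m(R)$. Composition with the morphisms of formal spectra induced by $F_{[m]}$ and $E_{[m]}$ defines morphisms over $\phi:S\to S$ (that is, natural maps from $B$-points to $B^\phi$-points) $$\mathfrak f_m:N^{[m]n}X\to N^{[m]n-1}X\ (m\ge 0,\ n\ge 1),\qquad \Phi_{[m]}:N^{[m]n}X\to N^{[m-1]n}X\ (m\ge 1,\ n\ge 0).$$ **Theorem.** For all $m,n\ge1$, $$\mathfrak f_{m-1}\circ\Phi_{[m]}=\Phi_{[m]}\circ\mathfrak f_m \;:\; N^{[m]n}X\longrightarrow N^{[m-1]n-1}X .$$ -/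

import Mathlib

open CategoryTheory CategoryTheory.Limits AlgebraicGeometry
universe u v w w'

set_option linter.unusedSectionVars false
set_option linter.unusedSimpArgs false
set_option linter.unusedVariables false

namespace ArithJet

/-- A ring `R` with an element `π`, a power `q` of a prime number `p` divisible by `π` in `R`, and a
lift `φ` of the `q`-power Frobenius of `R / π` with `φ π = π`; `R` has no `π`-torsion. -/
structure FrobeniusLift (R : Type u) [CommRing R] where
  π : R
  q : ℕ
  q_spec : ∃ p h : ℕ, p.Prime ∧ 0 < h ∧ q = p ^ h ∧ π ∣ (p : R)
  regular : ∀ x : R, π * x = 0 → x = 0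
  φ : R →+* R
  φ_π : φ π = π
  φ_lift : ∀ x : R, π ∣ φ x - x ^ q

section Dedekind

/-- The data attached to a Dedekind domain `O`, a nonzero prime `𝔭` with finite residue field, a
generator `π` of `𝔭 O_𝔭`, and an `O_𝔭`-algebra `R` with an `O_𝔭`-linear lift `φ` of the `q`-power
Frobenius modulo `π`, where `q` is the number of elements of `O / 𝔭`. -/
noncomputable def FrobeniusLift.ofDedekind {O : Type v} [CommRing O] [IsDedekindDomain O]
    (𝔭 : Ideal O) [𝔭.IsPrime] [Finite (O ⧸ 𝔭)] (π : Localization.AtPrime 𝔭)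
    (hπ : Ideal.span {π} = IsLocalRing.maximalIdeal (Localization.AtPrime 𝔭))
    {R : Type u} [CommRing R] [IsDomain R] [Algebra (Localization.AtPrime 𝔭) R]
    (hπR : algebraMap (Localization.AtPrime 𝔭) R π ≠ 0)
    (φ : R →ₐ[Localization.AtPrime 𝔭] R)
    (hφ : ∀ x : R, algebraMap (Localization.AtPrime 𝔭) R π ∣ φ x - x ^ Nat.card (O ⧸ 𝔭)) :
    FrobeniusLift R where
  π := algebraMap (Localization.AtPrime 𝔭) R π
  q := Nat.card (O ⧸ 𝔭)
  q_spec := by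
    have : IsDomain (O ⧸ 𝔭) := Ideal.Quotient.isDomain 𝔭
    let : Field (O ⧸ 𝔭) := (Finite.isField_of_domain (O ⧸ 𝔭)).toField
    let : Fintype (O ⧸ 𝔭) := Fintype.ofFinite _
    obtain ⟨p, hp⟩ := CharP.exists (O ⧸ 𝔭)
    obtain ⟨h, hprime, hcard⟩ := FiniteField.card (O ⧸ 𝔭) p
    refine ⟨p, h, hprime, h.pos, by rw [Nat.card_eq_fintype_card, hcard], ?_⟩
    have h1 : (p : O) ∈ 𝔭 := by
      rw [← Ideal.Quotient.eq_zero_iff_mem, map_natCast]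
      exact CharP.cast_eq_zero _ p
    have h2 : (p : Localization.AtPrime 𝔭) ∈ Ideal.span {π} := by
      rw [hπ, ← Localization.AtPrime.map_eq_maximalIdeal, ← map_natCast (algebraMap O _)]
      exact Ideal.mem_map_of_mem _ h1
    have h3 := map_dvd (algebraMap (Localization.AtPrime 𝔭) R) (Ideal.mem_span_singleton.1 h2)
    rwa [map_natCast] at h3
  regular := fun x hx => (mul_eq_zero.1 hx).resolve_left hπR
  φ := (φ : R →+* R)
  φ_π := φ.commutes π
  φ_lift := hφ

end Dedekind

section Ghost

variable {R : Type u} [CommRing R] (D : FrobeniusLift R)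
variable {A : Type w} [CommRing A] [Algebra R A] {A' : Type w'} [CommRing A'] [Algebra R A']

/-- The ghost polynomials `w_i = x_0 ^ (q ^ i) + π x_1 ^ (q ^ (i - 1)) + ... + π ^ i x_i`. -/
def gh (x : ℕ → A) (i : ℕ) : A :=
  ∑ j ∈ Finset.range (i + 1), algebraMap R A D.π ^ j * x j ^ D.q ^ (i - j)

/-- `A` has no `π`-torsion. -/
def TorsionFree (A : Type w) [CommRing A] [Algebra R A] : Prop :=
  ∀ a : A, algebraMap R A D.π * a = 0 → a = 0

variable {D}

theorem q_pos : 0 < D.q := by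
  obtain ⟨p, h, hp, _, hq, _⟩ := D.q_spec
  rw [hq]; exact pow_pos hp.pos _

theorem gh_zero (x : ℕ → A) : gh D x 0 = x 0 := by simp [gh]

theorem gh_succ (x : ℕ → A) (i : ℕ) :
    gh D x (i + 1) = gh D (fun j => x j ^ D.q) i + algebraMap R A D.π ^ (i + 1) * x (i + 1) := by
  unfold gh
  rw [Finset.sum_range_succ]
  congr 1
  · refine Finset.sum_congr rfl fun j hj => ?_
    have : i + 1 - j = (i - j) + 1 := by
      have := Finset.mem_range.1 hj; omega
    rw [this, ← pow_mul, ← pow_succ']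
  · simp

theorem gh_congr {x y : ℕ → A} {i : ℕ} (h : ∀ j ≤ i, x j = y j) : gh D x i = gh D y i := by
  refine Finset.sum_congr rfl fun j hj => ?_
  rw [h j (Nat.lt_succ_iff.1 (Finset.mem_range.1 hj))]

theorem gh_map (f : A →+* A') (hf : f (algebraMap R A D.π) = algebraMap R A' D.π) (x : ℕ → A)
    (i : ℕ) : f (gh D x i) = gh D (fun j => f (x j)) i := by
  simp [gh, map_sum, hf]

theorem gh_map_alg (f : A →ₐ[R] A') (x : ℕ → A) (i : ℕ) :
    f (gh D x i) = gh D (fun j => f (x j)) i :=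
  gh_map (f : A →+* A') (by simp) x i

theorem TorsionFree.pow (hA : TorsionFree D A) {n : ℕ} {a : A}
    (h : algebraMap R A D.π ^ n * a = 0) : a = 0 := by
  induction n with
  | zero => simpa using h
  | succ n ih => exact ih (hA _ (by rw [← mul_assoc, ← pow_succ', h]))

theorem gh_inj (hA : TorsionFree D A) {x y : ℕ → A} {N : ℕ}
    (h : ∀ i ≤ N, gh D x i = gh D y i) : ∀ i ≤ N, x i = y i := by
  intro i
  induction i using Nat.strong_induction_on with
  | _ i ih =>
    intro hi
    rcases i with _ | i
    · simpa [gh_zero] using h 0 hi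
    · have h1 := h (i + 1) hi
      rw [gh_succ, gh_succ, gh_congr (D := D) (y := fun j => y j ^ D.q)
        (fun j hj => by rw [ih j (by omega) (by omega)])] at h1
      have h2 := add_left_cancel h1
      exact sub_eq_zero.1 (hA.pow (n := i + 1) (by rw [mul_sub, h2, sub_self]))

theorem π_dvd_q : algebraMap R A D.π ∣ (D.q : A) := by
  obtain ⟨p, h, _, hh, hq, hd⟩ := D.q_spec
  have h1 := map_dvd (algebraMap R A) hd
  rw [map_natCast] at h1
  rw [hq, Nat.cast_pow]
  exact dvd_pow h1 hh.ne'

theorem pow_q_congr {a b : A} {k : ℕ} (h : algebraMap R A D.π ^ (k + 1) ∣ a - b) :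
    algebraMap R A D.π ^ (k + 2) ∣ a ^ D.q - b ^ D.q := by
  rw [← Commute.geom_sum₂_mul (Commute.all a b) D.q, pow_succ']
  refine mul_dvd_mul ?_ h
  have hab : Ideal.Quotient.mk (Ideal.span {algebraMap R A D.π}) a
      = Ideal.Quotient.mk (Ideal.span {algebraMap R A D.π}) b := by
    rw [Ideal.Quotient.eq, Ideal.mem_span_singleton]
    exact (dvd_pow_self _ (Nat.succ_ne_zero k)).trans h
  rw [← Ideal.mem_span_singleton, ← Ideal.Quotient.eq_zero_iff_mem, map_sum]
  simp only [map_mul, map_pow, hab]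
  have : ∀ i ∈ Finset.range D.q, (Ideal.Quotient.mk (Ideal.span {algebraMap R A D.π}) b) ^ i *
      (Ideal.Quotient.mk (Ideal.span {algebraMap R A D.π}) b) ^ (D.q - 1 - i) =
      (Ideal.Quotient.mk (Ideal.span {algebraMap R A D.π}) b) ^ (D.q - 1) := by
    intro i hi
    rw [← pow_add]; congr 1
    have := Finset.mem_range.1 hi; omega
  rw [Finset.sum_congr rfl this, Finset.sum_const, Finset.card_range, nsmul_eq_mul]
  have hq : ((D.q : ℕ) : A ⧸ Ideal.span {algebraMap R A D.π}) = 0 := by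
    rw [← map_natCast (Ideal.Quotient.mk _), Ideal.Quotient.eq_zero_iff_mem,
      Ideal.mem_span_singleton]
    exact π_dvd_q
  rw [hq, zero_mul]

theorem pow_q_pow_congr {a b : A} (h : algebraMap R A D.π ∣ a - b) (k : ℕ) :
    algebraMap R A D.π ^ (k + 1) ∣ a ^ D.q ^ k - b ^ D.q ^ k := by
  induction k with
  | zero => simpa using h
  | succ k ih => simpa only [pow_succ D.q, pow_mul] using pow_q_congr ih

/-- Half of Dwork's lemma: ghost vectors satisfy the congruences. -/
theorem gh_dvd (ψ : A →+* A) (hψ : ψ (algebraMap R A D.π) = algebraMap R A D.π)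
    (hl : ∀ a, algebraMap R A D.π ∣ ψ a - a ^ D.q) (x : ℕ → A) (i : ℕ) :
    algebraMap R A D.π ^ (i + 1) ∣ gh D x (i + 1) - ψ (gh D x i) := by
  rw [gh_succ, gh_map ψ hψ, add_sub_right_comm]
  refine dvd_add ?_ (dvd_mul_right _ _)
  unfold gh
  rw [← Finset.sum_sub_distrib]
  refine Finset.dvd_sum fun j hj => ?_
  rw [← mul_sub]
  have hj' : j ≤ i := Nat.lt_succ_iff.1 (Finset.mem_range.1 hj)
  have : i + 1 = j + ((i - j) + 1) := by omega
  rw [this, pow_add]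
  refine mul_dvd_mul_left _ ?_
  have h2 := pow_q_pow_congr (D := D) (hl (x j)) (i - j)
  rw [dvd_sub_comm]; exact h2

/-- The other half of Dwork's lemma. -/
theorem exists_gh (hA : TorsionFree D A) (ψ : A →+* A)
    (hψ : ψ (algebraMap R A D.π) = algebraMap R A D.π)
    (hl : ∀ a, algebraMap R A D.π ∣ ψ a - a ^ D.q) (a : ℕ → A)
    (ha : ∀ i, algebraMap R A D.π ^ (i + 1) ∣ a (i + 1) - ψ (a i)) :
    ∃ x : ℕ → A, ∀ i, gh D x i = a i := by
  have key : ∀ N, ∃ x : ℕ → A, ∀ i ≤ N, gh D x i = a i := by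
    intro N
    induction N with
    | zero => exact ⟨a, fun i hi => by obtain rfl := Nat.le_zero.1 hi; exact gh_zero a⟩
    | succ N ih =>
      obtain ⟨x, hx⟩ := ih
      have h1 : algebraMap R A D.π ^ (N + 1) ∣ a (N + 1) - gh D (fun j => x j ^ D.q) N := by
        have e : a (N + 1) - gh D (fun j => x j ^ D.q) N = (a (N + 1) - ψ (a N))
            - (gh D x (N + 1) - ψ (gh D x N)) + algebraMap R A D.π ^ (N + 1) * x (N + 1) := by
          rw [gh_succ, hx N le_rfl]; ring
        rw [e]
        exact dvd_add (dvd_sub (ha N) (gh_dvd ψ hψ hl x N)) (dvd_mul_right _ _)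
      obtain ⟨c, hc⟩ := h1
      refine ⟨Function.update x (N + 1) c, fun i hi => ?_⟩
      rcases Nat.lt_or_ge i (N + 1) with h | h
      · rw [← hx i (by omega)]
        exact gh_congr fun j hj => Function.update_of_ne (by omega) _ _
      · obtain rfl : i = N + 1 := by omega
        rw [gh_succ, Function.update_self, ← hc,
          gh_congr (D := D) (y := fun j => x j ^ D.q) (fun j hj => by
            rw [Function.update_of_ne (by omega)])]
        ring
  choose x hx using key
  refine ⟨fun i => x i i, fun i => ?_⟩
  rw [← hx i i le_rfl]
  refine gh_congr fun j hj => ?_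
  exact gh_inj hA (N := j) (fun k hk => by rw [hx j k hk, hx i k (hk.trans hj)]) j le_rfl

variable (D) in
theorem torsionFree_self : TorsionFree D R := fun a h => D.regular a h

variable (D) in
theorem torsionFree_mvPolynomial (σ : Type w) : TorsionFree D (MvPolynomial σ R) := by
  intro f h
  ext s
  have := congrArg (MvPolynomial.coeff s) h
  rw [MvPolynomial.algebraMap_eq, MvPolynomial.coeff_C_mul, MvPolynomial.coeff_zero] at this
  rw [D.regular _ this, MvPolynomial.coeff_zero]

variable (D) in
/-- The lift of Frobenius on a polynomial ring with `X ↦ X ^ q`. -/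
noncomputable def polyFrob (σ : Type w) : MvPolynomial σ R →+* MvPolynomial σ R :=
  MvPolynomial.eval₂Hom (MvPolynomial.C.comp D.φ) (fun s => MvPolynomial.X s ^ D.q)

theorem polyFrob_π (σ : Type w) :
    polyFrob D σ (algebraMap R _ D.π) = algebraMap R (MvPolynomial σ R) D.π := by
  simp [polyFrob, MvPolynomial.algebraMap_eq, D.φ_π]

theorem polyFrob_lift (σ : Type w) (f : MvPolynomial σ R) :
    algebraMap R (MvPolynomial σ R) D.π ∣ polyFrob D σ f - f ^ D.q := by
  induction f using MvPolynomial.induction_on with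
  | C a =>
    have := map_dvd (algebraMap R (MvPolynomial σ R)) (D.φ_lift a)
    simpa [polyFrob, MvPolynomial.algebraMap_eq] using this
  | add f g hf hg =>
    obtain ⟨p, h, hp, hh, hq, hd⟩ := D.q_spec
    obtain ⟨r, hr⟩ := exists_add_pow_prime_pow_eq hp f g h
    have h1 := map_dvd (algebraMap R (MvPolynomial σ R)) hd
    rw [map_natCast] at h1
    rw [map_add]
    have e : polyFrob D σ f + polyFrob D σ g - (f + g) ^ D.q =
        (polyFrob D σ f - f ^ D.q) + (polyFrob D σ g - g ^ D.q)
          - ((f + g) ^ D.q - f ^ D.q - g ^ D.q) := by ring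
    rw [e]
    refine dvd_sub (dvd_add hf hg) ?_
    rw [hq, hr]
    have e2 : ∀ z : MvPolynomial σ R, f ^ p ^ h + g ^ p ^ h + z - f ^ p ^ h - g ^ p ^ h = z := by
      intro z; ring
    rw [e2]
    simp only [mul_assoc]
    exact h1.mul_right _
  | mul_X f s hf =>
    have : polyFrob D σ (MvPolynomial.X s) = MvPolynomial.X s ^ D.q := by simp [polyFrob]
    rw [map_mul, this, mul_pow, ← sub_mul]
    exact hf.mul_right _

theorem exists_gh_poly {σ : Type w} (a : ℕ → MvPolynomial σ R)
    (ha : ∀ i, algebraMap R (MvPolynomial σ R) D.π ^ (i + 1) ∣ a (i + 1) - polyFrob D σ (a i)) :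
    ∃ x : ℕ → MvPolynomial σ R, ∀ i, gh D x i = a i :=
  exists_gh (torsionFree_mvPolynomial D σ) _ (polyFrob_π σ) (polyFrob_lift σ) a ha

theorem gh_dvd_poly {σ : Type w} (x : ℕ → MvPolynomial σ R) (i : ℕ) :
    algebraMap R (MvPolynomial σ R) D.π ^ (i + 1) ∣ gh D x (i + 1) - polyFrob D σ (gh D x i) :=
  gh_dvd _ (polyFrob_π σ) (polyFrob_lift σ) x i

/-- If the ghost components of a sequence of polynomials are fixed by `φ` on coefficients, so are
the polynomials. -/
theorem map_φ_eq {σ : Type w} {s a : ℕ → MvPolynomial σ R} (h : ∀ i, gh D s i = a i)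
    (ha : ∀ i, MvPolynomial.map D.φ (a i) = a i) (i : ℕ) :
    MvPolynomial.map D.φ (s i) = s i := by
  refine gh_inj (torsionFree_mvPolynomial D σ) (N := i)
    (x := fun j => MvPolynomial.map D.φ (s j)) (y := s) (fun j _ => ?_) i le_rfl
  rw [← gh_map (MvPolynomial.map D.φ) (by simp [MvPolynomial.algebraMap_eq, D.φ_π]), h, ha]

theorem map_φ_gh_X {σ : Type w} (v : ℕ → σ) (i : ℕ) :
    MvPolynomial.map D.φ (gh D (fun j => (MvPolynomial.X (v j) : MvPolynomial σ R)) i) =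
      gh D (fun j => (MvPolynomial.X (v j) : MvPolynomial σ R)) i := by
  rw [gh_map (MvPolynomial.map D.φ) (by simp [MvPolynomial.algebraMap_eq, D.φ_π])]
  simp

end Ghost
section Witt

variable {R : Type u} [CommRing R] (D : FrobeniusLift R)

/-- The generic sequence with index `b`. -/
noncomputable def gen (b : Bool) (i : ℕ) : MvPolynomial (Bool × ℕ) R := MvPolynomial.X (b, i)

theorem polyFrob_dvd_add {σ : Type w} (a b : ℕ → MvPolynomial σ R) :
    ∃ s : ℕ → MvPolynomial σ R, ∀ i, gh D s i = gh D a i + gh D b i := by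
  refine exists_gh_poly _ fun i => ?_
  have e := dvd_add (gh_dvd_poly (D := D) a i) (gh_dvd_poly (D := D) b i)
  rw [map_add]
  convert e using 1
  ring

theorem polyFrob_dvd_mul {σ : Type w} (a b : ℕ → MvPolynomial σ R) :
    ∃ s : ℕ → MvPolynomial σ R, ∀ i, gh D s i = gh D a i * gh D b i := by
  refine exists_gh_poly _ fun i => ?_
  have e := dvd_add ((gh_dvd_poly (D := D) a i).mul_right (gh D b (i + 1)))
    ((gh_dvd_poly (D := D) b i).mul_left (polyFrob D σ (gh D a i)))
  rw [map_mul]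
  convert e using 1
  ring

theorem polyFrob_dvd_neg {σ : Type w} (a : ℕ → MvPolynomial σ R) :
    ∃ s : ℕ → MvPolynomial σ R, ∀ i, gh D s i = - gh D a i := by
  refine exists_gh_poly _ fun i => ?_
  have e := dvd_neg.2 (gh_dvd_poly (D := D) a i)
  rw [map_neg]
  convert e using 1
  ring

theorem polyFrob_dvd_shift {σ : Type w} (a : ℕ → MvPolynomial σ R) :
    ∃ s : ℕ → MvPolynomial σ R, ∀ i, gh D s i = gh D a (i + 1) := by
  refine exists_gh_poly _ fun i => ?_
  exact (pow_dvd_pow _ (Nat.le_succ _)).trans (gh_dvd_poly (D := D) a (i + 1))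

theorem polyFrob_dvd_lat {σ : Type w} (a : ℕ → MvPolynomial σ R) (m : ℕ) :
    ∃ s : ℕ → MvPolynomial σ R, ∀ i, gh D s i =
      if i ≤ m then polyFrob D σ (gh D a i) else gh D a (i + 1) := by
  refine exists_gh_poly _ fun i => ?_
  rcases Nat.lt_trichotomy i m with h | h | h
  · rw [if_pos (by omega), if_pos (by omega), ← map_sub]
    have := map_dvd (polyFrob D σ) (gh_dvd_poly (D := D) a i)
    rwa [map_pow, polyFrob_π] at this
  · rw [if_neg (by omega), if_pos (by omega)]
    have h1 := map_dvd (polyFrob D σ) (gh_dvd_poly (D := D) a i)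
    rw [map_pow, polyFrob_π, map_sub] at h1
    have h2 := (pow_dvd_pow _ (Nat.le_succ _)).trans (gh_dvd_poly (D := D) a (i + 1))
    have e := dvd_add h1 h2
    convert e using 1
    ring
  · rw [if_neg (by omega), if_neg (by omega)]
    exact (pow_dvd_pow _ (Nat.le_succ _)).trans (gh_dvd_poly (D := D) a (i + 1))

/-- The polynomials of Witt vector addition: the unique ones whose ghost components are the sums
of the ghost components of the two generic sequences. -/
noncomputable def addPoly : ℕ → MvPolynomial (Bool × ℕ) R :=
  (polyFrob_dvd_add D (gen false) (gen true)).choose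

/-- The polynomials of Witt vector multiplication. -/
noncomputable def mulPoly : ℕ → MvPolynomial (Bool × ℕ) R :=
  (polyFrob_dvd_mul D (gen false) (gen true)).choose

/-- The polynomials of Witt vector negation. -/
noncomputable def negPoly : ℕ → MvPolynomial ℕ R :=
  (polyFrob_dvd_neg D MvPolynomial.X).choose

/-- The polynomials `F_i` of the Witt vector Frobenius: the `i`-th ghost component is the
`(i + 1)`-st ghost component of the generic sequence. -/
noncomputable def frobPoly : ℕ → MvPolynomial ℕ R :=
  (polyFrob_dvd_shift D MvPolynomial.X).choose

/-! The structure polynomials are fixed by `φ` on coefficients. Hence the ring `W_n(B)` and the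
Frobenius do not change if the structure map of `B` is precomposed with a power of `φ`. -/

theorem map_φ_addPoly (i : ℕ) : MvPolynomial.map D.φ (addPoly D i) = addPoly D i :=
  map_φ_eq (polyFrob_dvd_add D (gen false) (gen true)).choose_spec (fun i => by
    rw [map_add]
    exact congrArg₂ (· + ·) (map_φ_gh_X (fun j => (false, j)) i)
      (map_φ_gh_X (fun j => (true, j)) i)) i

theorem map_φ_mulPoly (i : ℕ) : MvPolynomial.map D.φ (mulPoly D i) = mulPoly D i :=
  map_φ_eq (polyFrob_dvd_mul D (gen false) (gen true)).choose_spec (fun i => by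
    rw [map_mul]
    exact congrArg₂ (· * ·) (map_φ_gh_X (fun j => (false, j)) i)
      (map_φ_gh_X (fun j => (true, j)) i)) i

theorem map_φ_frobPoly (i : ℕ) : MvPolynomial.map D.φ (frobPoly D i) = frobPoly D i :=
  map_φ_eq (polyFrob_dvd_shift D MvPolynomial.X).choose_spec
    (fun i => map_φ_gh_X (fun j => j) (i + 1)) i

/-- The truncated `π`-typical Witt vectors `W_n(B) = B ^ (n + 1)` of length `n + 1`. -/
@[ext]
structure TruncWitt {R : Type u} [CommRing R] (_D : FrobeniusLift R) (n : ℕ) (B : Type w) where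
  coeff : Fin (n + 1) → B

namespace TruncWitt

variable {D} {n : ℕ} {B : Type w} [CommRing B] {B' : Type w'} [CommRing B']

/-- The coordinates as a sequence, continued by zero. -/
def seq (x : TruncWitt D n B) (i : ℕ) : B :=
  if h : i < n + 1 then x.coeff ⟨i, h⟩ else 0

variable (D n) in
/-- The Witt vector with given coordinates. -/
def ofSeq {B : Type w} (s : ℕ → B) : TruncWitt D n B := ⟨fun i => s i⟩

theorem seq_ofSeq (s : ℕ → B) {i : ℕ} (h : i ≤ n) : (ofSeq D n s).seq i = s i := by
  simp [seq, ofSeq, Nat.lt_succ_iff.2 h]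

theorem ext_seq {x y : TruncWitt D n B} (h : ∀ i ≤ n, x.seq i = y.seq i) : x = y := by
  ext i
  simpa only [seq, dif_pos i.2] using h i (Nat.lt_succ_iff.1 i.2)

variable [Algebra R B] [Algebra R B']

/-- The ghost components. -/
def ghost (x : TruncWitt D n B) (i : ℕ) : B := gh D x.seq i

theorem ghost_ofSeq (s : ℕ → B) {i : ℕ} (h : i ≤ n) : (ofSeq D n s).ghost i = gh D s i :=
  gh_congr fun _ hj => seq_ofSeq s (hj.trans h)

theorem ghost_ext (hB : TorsionFree D B) {x y : TruncWitt D n B}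
    (h : ∀ i ≤ n, x.ghost i = y.ghost i) : x = y :=
  ext_seq (gh_inj hB h)

/-- Pairs of sequences as valuations. -/
def pairVal (x y : ℕ → B) (s : Bool × ℕ) : B := if s.1 then y s.2 else x s.2

noncomputable instance : Zero (TruncWitt D n B) := ⟨ofSeq D n fun _ => 0⟩
noncomputable instance : One (TruncWitt D n B) := ⟨ofSeq D n fun i => if i = 0 then 1 else 0⟩
noncomputable instance : Add (TruncWitt D n B) :=
  ⟨fun x y => ofSeq D n fun i => MvPolynomial.aeval (pairVal x.seq y.seq) (addPoly D i)⟩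
noncomputable instance : Mul (TruncWitt D n B) :=
  ⟨fun x y => ofSeq D n fun i => MvPolynomial.aeval (pairVal x.seq y.seq) (mulPoly D i)⟩
noncomputable instance : Neg (TruncWitt D n B) :=
  ⟨fun x => ofSeq D n fun i => MvPolynomial.aeval x.seq (negPoly D i)⟩

theorem ghost_zero {i : ℕ} (h : i ≤ n) : (0 : TruncWitt D n B).ghost i = 0 := by
  refine (ghost_ofSeq (fun _ => 0) h).trans ?_
  unfold gh
  refine Finset.sum_eq_zero fun j _ => ?_
  rw [zero_pow (pow_pos q_pos _).ne', mul_zero]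

theorem ghost_one {i : ℕ} (h : i ≤ n) : (1 : TruncWitt D n B).ghost i = 1 := by
  refine (ghost_ofSeq (fun i => if i = 0 then 1 else 0) h).trans ?_
  unfold gh
  rw [Finset.sum_eq_single 0]
  · simp
  · intro j _ hj
    simp only [if_neg hj]
    rw [zero_pow (pow_pos q_pos _).ne', mul_zero]
  · simp

theorem aeval_gen_false (x y : ℕ → B) (j : ℕ) :
    MvPolynomial.aeval (pairVal x y) (gen (R := R) false j) = x j := by simp [gen, pairVal]

theorem aeval_gen_true (x y : ℕ → B) (j : ℕ) :
    MvPolynomial.aeval (pairVal x y) (gen (R := R) true j) = y j := by simp [gen, pairVal]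

theorem ghost_add (x y : TruncWitt D n B) {i : ℕ} (h : i ≤ n) :
    (x + y).ghost i = x.ghost i + y.ghost i := by
  refine (ghost_ofSeq (fun i => MvPolynomial.aeval (pairVal x.seq y.seq) (addPoly D i)) h).trans ?_
  have e := congrArg (MvPolynomial.aeval (pairVal x.seq y.seq))
    ((polyFrob_dvd_add D (gen false) (gen true)).choose_spec i)
  rw [map_add, gh_map_alg, gh_map_alg, gh_map_alg] at e
  simp only [aeval_gen_false, aeval_gen_true] at e
  exact e

theorem ghost_mul (x y : TruncWitt D n B) {i : ℕ} (h : i ≤ n) :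
    (x * y).ghost i = x.ghost i * y.ghost i := by
  refine (ghost_ofSeq (fun i => MvPolynomial.aeval (pairVal x.seq y.seq) (mulPoly D i)) h).trans ?_
  have e := congrArg (MvPolynomial.aeval (pairVal x.seq y.seq))
    ((polyFrob_dvd_mul D (gen false) (gen true)).choose_spec i)
  rw [map_mul, gh_map_alg, gh_map_alg, gh_map_alg] at e
  simp only [aeval_gen_false, aeval_gen_true] at e
  exact e

theorem ghost_neg (x : TruncWitt D n B) {i : ℕ} (h : i ≤ n) :
    (-x).ghost i = -x.ghost i := by
  refine (ghost_ofSeq (fun i => MvPolynomial.aeval x.seq (negPoly D i)) h).trans ?_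
  have e := congrArg (MvPolynomial.aeval x.seq)
    ((polyFrob_dvd_neg D MvPolynomial.X).choose_spec i)
  rw [map_neg, gh_map_alg, gh_map_alg] at e
  simp only [MvPolynomial.aeval_X] at e
  exact e

/-- Functoriality on underlying sets. -/
def mapFun (f : B → B') (x : TruncWitt D n B) : TruncWitt D n B' := ⟨fun i => f (x.coeff i)⟩

theorem seq_mapFun (f : B →+* B') (x : TruncWitt D n B) (i : ℕ) :
    (mapFun f x).seq i = f (x.seq i) := by
  unfold seq mapFun; split_ifs <;> simp

theorem pairVal_map (f : B →ₐ[R] B') (x y : TruncWitt D n B) (s : Bool × ℕ) :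
    pairVal (mapFun f x).seq (mapFun f y).seq s = f (pairVal x.seq y.seq s) := by
  have h := seq_mapFun (D := D) (n := n) (f : B →+* B')
  simp only [RingHom.coe_coe] at h
  unfold pairVal
  split_ifs
  · exact h y _
  · exact h x _

theorem seq_mapFun' (f : B →ₐ[R] B') (x : TruncWitt D n B) (i : ℕ) :
    (mapFun f x).seq i = f (x.seq i) := seq_mapFun (f : B →+* B') x i

theorem seq_add (x y : TruncWitt D n B) {i : ℕ} (h : i ≤ n) :
    (x + y).seq i = MvPolynomial.aeval (pairVal x.seq y.seq) (addPoly D i) :=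
  seq_ofSeq (D := D) (fun i => MvPolynomial.aeval (pairVal x.seq y.seq) (addPoly D i)) h

theorem seq_mul (x y : TruncWitt D n B) {i : ℕ} (h : i ≤ n) :
    (x * y).seq i = MvPolynomial.aeval (pairVal x.seq y.seq) (mulPoly D i) :=
  seq_ofSeq (D := D) (fun i => MvPolynomial.aeval (pairVal x.seq y.seq) (mulPoly D i)) h

theorem seq_neg (x : TruncWitt D n B) {i : ℕ} (h : i ≤ n) :
    (-x).seq i = MvPolynomial.aeval x.seq (negPoly D i) :=
  seq_ofSeq (D := D) (fun i => MvPolynomial.aeval x.seq (negPoly D i)) h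

theorem seq_zero {i : ℕ} (h : i ≤ n) : (0 : TruncWitt D n B).seq i = 0 :=
  seq_ofSeq (D := D) (fun _ => (0 : B)) h

theorem seq_one {i : ℕ} (h : i ≤ n) : (1 : TruncWitt D n B).seq i = if i = 0 then 1 else 0 :=
  seq_ofSeq (D := D) (fun i => if i = 0 then (1 : B) else 0) h

theorem mapFun_zero (f : B →ₐ[R] B') : mapFun f (0 : TruncWitt D n B) = 0 :=
  ext_seq fun i hi => by rw [seq_mapFun', seq_zero hi, seq_zero hi, map_zero]

theorem mapFun_one (f : B →ₐ[R] B') : mapFun f (1 : TruncWitt D n B) = 1 :=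
  ext_seq fun i hi => by
    rw [seq_mapFun', seq_one hi, seq_one hi]
    split_ifs <;> simp

theorem mapFun_add (f : B →ₐ[R] B') (x y : TruncWitt D n B) :
    mapFun f (x + y) = mapFun f x + mapFun f y :=
  ext_seq fun i hi => by
    rw [seq_mapFun', seq_add _ _ hi, seq_add _ _ hi, MvPolynomial.comp_aeval_apply]
    exact congrArg (fun v => MvPolynomial.aeval v (addPoly D i))
      (funext fun s => (pairVal_map f x y s).symm)

theorem mapFun_mul (f : B →ₐ[R] B') (x y : TruncWitt D n B) :
    mapFun f (x * y) = mapFun f x * mapFun f y :=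
  ext_seq fun i hi => by
    rw [seq_mapFun', seq_mul _ _ hi, seq_mul _ _ hi, MvPolynomial.comp_aeval_apply]
    exact congrArg (fun v => MvPolynomial.aeval v (mulPoly D i))
      (funext fun s => (pairVal_map f x y s).symm)

theorem mapFun_neg (f : B →ₐ[R] B') (x : TruncWitt D n B) :
    mapFun f (-x) = -mapFun f x :=
  ext_seq fun i hi => by
    rw [seq_mapFun', seq_neg _ hi, seq_neg _ hi, MvPolynomial.comp_aeval_apply]
    exact congrArg (fun v => MvPolynomial.aeval v (negPoly D i))
      (funext fun s => (seq_mapFun' f x s).symm)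

variable (R) in
/-- The canonical presentation of `B` by a polynomial ring. -/
noncomputable def pres (B : Type w) [CommRing B] [Algebra R B] : MvPolynomial B R →ₐ[R] B :=
  MvPolynomial.aeval id

theorem mapFun_pres_surjective :
    Function.Surjective (mapFun (D := D) (n := n) (pres R B)) := fun x =>
  ⟨⟨fun i => MvPolynomial.X (x.coeff i)⟩, by ext i; simp [mapFun, pres]⟩

theorem add_assoc' (a b c : TruncWitt D n B) : a + b + c = a + (b + c) := by
  obtain ⟨a, rfl⟩ := mapFun_pres_surjective (R := R) a
  obtain ⟨b, rfl⟩ := mapFun_pres_surjective (R := R) b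
  obtain ⟨c, rfl⟩ := mapFun_pres_surjective (R := R) c
  simp only [← mapFun_add]
  refine congrArg (mapFun (pres R B)) (ghost_ext (torsionFree_mvPolynomial D B) fun i hi => ?_)
  simp only [ghost_add _ _ hi, ghost_mul _ _ hi, ghost_neg _ hi, ghost_zero hi, ghost_one hi]
  ring

theorem zero_add' (a : TruncWitt D n B) : 0 + a = a := by
  obtain ⟨a, rfl⟩ := mapFun_pres_surjective (R := R) a
  rw [← mapFun_zero (pres R B), ← mapFun_add]
  refine congrArg (mapFun (pres R B)) (ghost_ext (torsionFree_mvPolynomial D B) fun i hi => ?_)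
  simp only [ghost_add _ _ hi, ghost_mul _ _ hi, ghost_neg _ hi, ghost_zero hi, ghost_one hi]
  ring

theorem neg_add_cancel' (a : TruncWitt D n B) : -a + a = 0 := by
  obtain ⟨a, rfl⟩ := mapFun_pres_surjective (R := R) a
  rw [← mapFun_zero (pres R B), ← mapFun_neg, ← mapFun_add]
  refine congrArg (mapFun (pres R B)) (ghost_ext (torsionFree_mvPolynomial D B) fun i hi => ?_)
  simp only [ghost_add _ _ hi, ghost_mul _ _ hi, ghost_neg _ hi, ghost_zero hi, ghost_one hi]
  ring

theorem mul_assoc' (a b c : TruncWitt D n B) : a * b * c = a * (b * c) := by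
  obtain ⟨a, rfl⟩ := mapFun_pres_surjective (R := R) a
  obtain ⟨b, rfl⟩ := mapFun_pres_surjective (R := R) b
  obtain ⟨c, rfl⟩ := mapFun_pres_surjective (R := R) c
  simp only [← mapFun_mul]
  refine congrArg (mapFun (pres R B)) (ghost_ext (torsionFree_mvPolynomial D B) fun i hi => ?_)
  simp only [ghost_add _ _ hi, ghost_mul _ _ hi, ghost_neg _ hi, ghost_zero hi, ghost_one hi]
  ring

theorem mul_comm' (a b : TruncWitt D n B) : a * b = b * a := by
  obtain ⟨a, rfl⟩ := mapFun_pres_surjective (R := R) a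
  obtain ⟨b, rfl⟩ := mapFun_pres_surjective (R := R) b
  simp only [← mapFun_mul]
  refine congrArg (mapFun (pres R B)) (ghost_ext (torsionFree_mvPolynomial D B) fun i hi => ?_)
  simp only [ghost_add _ _ hi, ghost_mul _ _ hi, ghost_neg _ hi, ghost_zero hi, ghost_one hi]
  ring

theorem one_mul' (a : TruncWitt D n B) : 1 * a = a := by
  obtain ⟨a, rfl⟩ := mapFun_pres_surjective (R := R) a
  rw [← mapFun_one (pres R B), ← mapFun_mul]
  refine congrArg (mapFun (pres R B)) (ghost_ext (torsionFree_mvPolynomial D B) fun i hi => ?_)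
  simp only [ghost_add _ _ hi, ghost_mul _ _ hi, ghost_neg _ hi, ghost_zero hi, ghost_one hi]
  ring

theorem left_distrib' (a b c : TruncWitt D n B) : a * (b + c) = a * b + a * c := by
  obtain ⟨a, rfl⟩ := mapFun_pres_surjective (R := R) a
  obtain ⟨b, rfl⟩ := mapFun_pres_surjective (R := R) b
  obtain ⟨c, rfl⟩ := mapFun_pres_surjective (R := R) c
  simp only [← mapFun_mul, ← mapFun_add]
  refine congrArg (mapFun (pres R B)) (ghost_ext (torsionFree_mvPolynomial D B) fun i hi => ?_)
  simp only [ghost_add _ _ hi, ghost_mul _ _ hi, ghost_neg _ hi, ghost_zero hi, ghost_one hi]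
  ring

noncomputable instance : CommRing (TruncWitt D n B) :=
  CommRing.ofMinimalAxioms add_assoc' zero_add' neg_add_cancel' mul_assoc' mul_comm' one_mul'
    left_distrib'

/-- Functoriality of truncated Witt vectors. -/
noncomputable def map (f : B →ₐ[R] B') : TruncWitt D n B →+* TruncWitt D n B' where
  toFun := mapFun f
  map_one' := mapFun_one f
  map_mul' := mapFun_mul f
  map_zero' := mapFun_zero f
  map_add' := mapFun_add f

theorem map_pres_surjective : Function.Surjective (map (D := D) (n := n) (pres R B)) :=
  mapFun_pres_surjective

theorem ghost_map (f : B →ₐ[R] B') (x : TruncWitt D n B) (i : ℕ) :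
    (map f x).ghost i = f (x.ghost i) := by
  unfold ghost
  rw [gh_map_alg]
  exact gh_congr fun j _ => seq_mapFun' f x j

/-- Truncation on coordinates. -/
def truncFun {N M : ℕ} (x : TruncWitt D N B) : TruncWitt D M B := ofSeq D M x.seq

theorem ghost_truncFun {N M : ℕ} (x : TruncWitt D N B) {i : ℕ} (hi : i ≤ M) :
    (truncFun (M := M) x).ghost i = x.ghost i := ghost_ofSeq _ hi

theorem mapFun_truncFun {N M : ℕ} (f : B →ₐ[R] B') (x : TruncWitt D N B) :
    mapFun f (truncFun (M := M) x) = truncFun (mapFun f x) :=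
  ext_seq fun i hi => by
    rw [seq_mapFun', truncFun, truncFun, seq_ofSeq _ hi, seq_ofSeq _ hi, seq_mapFun']

/-- Truncation `W_N(B) ⟶ W_M(B)` as a ring homomorphism. -/
noncomputable def trunc {N M : ℕ} (h : M ≤ N) : TruncWitt D N B →+* TruncWitt D M B where
  toFun := truncFun
  map_one' := ext_seq fun i hi => by
    rw [truncFun, seq_ofSeq _ hi, seq_one hi, seq_one (hi.trans h)]
  map_zero' := ext_seq fun i hi => by
    rw [truncFun, seq_ofSeq _ hi, seq_zero hi, seq_zero (hi.trans h)]
  map_add' x y := by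
    obtain ⟨x, rfl⟩ := mapFun_pres_surjective (R := R) x
    obtain ⟨y, rfl⟩ := mapFun_pres_surjective (R := R) y
    simp only [← mapFun_truncFun, ← mapFun_add]
    refine congrArg (mapFun (pres R B)) (ghost_ext (torsionFree_mvPolynomial D B) fun i hi => ?_)
    simp only [ghost_add _ _ hi, ghost_truncFun _ hi, ghost_add _ _ (hi.trans h)]
  map_mul' x y := by
    obtain ⟨x, rfl⟩ := mapFun_pres_surjective (R := R) x
    obtain ⟨y, rfl⟩ := mapFun_pres_surjective (R := R) y
    simp only [← mapFun_truncFun, ← mapFun_mul]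
    refine congrArg (mapFun (pres R B)) (ghost_ext (torsionFree_mvPolynomial D B) fun i hi => ?_)
    simp only [ghost_mul _ _ hi, ghost_truncFun _ hi, ghost_mul _ _ (hi.trans h)]

/-- The Frobenius on coordinates. -/
noncomputable def frobFun {N M : ℕ} (x : TruncWitt D N B) : TruncWitt D M B :=
  ofSeq D M fun i => MvPolynomial.aeval x.seq (frobPoly D i)

theorem ghost_frobFun {N M : ℕ} (x : TruncWitt D N B) {i : ℕ} (hi : i ≤ M) :
    (frobFun (M := M) x).ghost i = x.ghost (i + 1) := by
  refine (ghost_ofSeq _ hi).trans ?_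
  have e := congrArg (MvPolynomial.aeval x.seq)
    ((polyFrob_dvd_shift D MvPolynomial.X).choose_spec i)
  rw [gh_map_alg, gh_map_alg] at e
  simp only [MvPolynomial.aeval_X] at e
  exact e

theorem mapFun_frobFun {N M : ℕ} (f : B →ₐ[R] B') (x : TruncWitt D N B) :
    mapFun f (frobFun (M := M) x) = frobFun (mapFun f x) :=
  ext_seq fun i hi => by
    rw [seq_mapFun', frobFun, frobFun, seq_ofSeq _ hi, seq_ofSeq _ hi,
      MvPolynomial.comp_aeval_apply]
    exact congrArg (fun v => MvPolynomial.aeval v (frobPoly D i))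
      (funext fun s => (seq_mapFun' f x s).symm)

/-- The Frobenius `F : W_(M+1)(B) ⟶ W_M(B)` as a ring homomorphism. -/
noncomputable def frob {N M : ℕ} (h : N = M + 1) : TruncWitt D N B →+* TruncWitt D M B where
  toFun := frobFun
  map_one' := by
    rw [← mapFun_one (pres R B), ← mapFun_one (pres R B), ← mapFun_frobFun]
    refine congrArg (mapFun (pres R B)) (ghost_ext (torsionFree_mvPolynomial D B) fun i hi => ?_)
    rw [ghost_frobFun _ hi, ghost_one hi, ghost_one (by omega)]
  map_zero' := by
    rw [← mapFun_zero (pres R B), ← mapFun_zero (pres R B), ← mapFun_frobFun]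
    refine congrArg (mapFun (pres R B)) (ghost_ext (torsionFree_mvPolynomial D B) fun i hi => ?_)
    rw [ghost_frobFun _ hi, ghost_zero hi, ghost_zero (by omega)]
  map_add' x y := by
    obtain ⟨x, rfl⟩ := mapFun_pres_surjective (R := R) x
    obtain ⟨y, rfl⟩ := mapFun_pres_surjective (R := R) y
    simp only [← mapFun_frobFun, ← mapFun_add]
    refine congrArg (mapFun (pres R B)) (ghost_ext (torsionFree_mvPolynomial D B) fun i hi => ?_)
    have hi' : i + 1 ≤ N := by omega
    simp only [ghost_add _ _ hi, ghost_frobFun _ hi, ghost_add _ _ hi']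
  map_mul' x y := by
    obtain ⟨x, rfl⟩ := mapFun_pres_surjective (R := R) x
    obtain ⟨y, rfl⟩ := mapFun_pres_surjective (R := R) y
    simp only [← mapFun_frobFun, ← mapFun_mul]
    refine congrArg (mapFun (pres R B)) (ghost_ext (torsionFree_mvPolynomial D B) fun i hi => ?_)
    have hi' : i + 1 ≤ N := by omega
    simp only [ghost_mul _ _ hi, ghost_frobFun _ hi, ghost_mul _ _ hi']

theorem ghost_mapφ (r : TruncWitt D n R) (i : ℕ) :
    (mapFun D.φ r).ghost i = D.φ (r.ghost i) := by
  unfold ghost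
  rw [gh_map D.φ (by simp [D.φ_π])]
  exact gh_congr fun j _ => seq_mapFun D.φ r j

/-- `φ` applied to all coordinates of Witt vectors over `R`, that is, `W_n(R) ⟶ W_n(R^φ)`
induced by the structure map of `R^φ`. -/
noncomputable def mapφ : TruncWitt D n R →+* TruncWitt D n R where
  toFun := mapFun D.φ
  map_one' := ghost_ext (torsionFree_self D) fun i hi => by
    rw [ghost_mapφ, ghost_one hi, map_one]
  map_zero' := ghost_ext (torsionFree_self D) fun i hi => by
    rw [ghost_mapφ, ghost_zero hi, map_zero]
  map_add' x y := ghost_ext (torsionFree_self D) fun i hi => by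
    simp only [ghost_mapφ, ghost_add _ _ hi, map_add]
  map_mul' x y := ghost_ext (torsionFree_self D) fun i hi => by
    simp only [ghost_mapφ, ghost_mul _ _ hi, map_mul]

theorem exists_expSeq (r : R) : ∃ s : ℕ → R, ∀ i, gh D s i = D.φ^[i] r :=
  exists_gh (torsionFree_self D) D.φ (by simp [D.φ_π]) D.φ_lift _ fun i => by
    rw [Function.iterate_succ_apply', sub_self]; exact dvd_zero _

variable (D) in
/-- The sequence with ghost components `r, φ r, φ (φ r), ...`. -/
noncomputable def expSeq (r : R) : ℕ → R := (exists_expSeq (D := D) r).choose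

theorem ghost_exp (r : R) {i : ℕ} (hi : i ≤ n) :
    (ofSeq D n (expSeq D r)).ghost i = D.φ^[i] r :=
  (ghost_ofSeq _ hi).trans ((exists_expSeq (D := D) r).choose_spec i)

variable (D n) in
/-- The universal map `exp_δ : R ⟶ W_n(R)`: the ring homomorphism such that `exp_δ r` has ghost
components `r, φ r, φ (φ r), ...`. -/
noncomputable def exp : R →+* TruncWitt D n R where
  toFun r := ofSeq D n (expSeq D r)
  map_one' := ghost_ext (torsionFree_self D) fun i hi => by
    rw [ghost_exp _ hi, ghost_one hi, iterate_map_one]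
  map_zero' := ghost_ext (torsionFree_self D) fun i hi => by
    rw [ghost_exp _ hi, ghost_zero hi, iterate_map_zero]
  map_add' x y := ghost_ext (torsionFree_self D) fun i hi => by
    simp only [ghost_exp _ hi, ghost_add _ _ hi, iterate_map_add]
  map_mul' x y := ghost_ext (torsionFree_self D) fun i hi => by
    simp only [ghost_exp _ hi, ghost_mul _ _ hi, iterate_map_mul]

theorem trunc_exp {N M : ℕ} (h : M ≤ N) (r : R) : trunc h (exp D N r) = exp D M r :=
  ext_seq fun _ hi => (seq_ofSeq _ hi).trans
    ((seq_ofSeq _ (hi.trans h)).trans (seq_ofSeq _ hi).symm)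

theorem mapφ_exp (r : R) : mapφ (exp D n r) = exp D n (D.φ r) :=
  ghost_ext (torsionFree_self D) fun i hi => by
    refine (ghost_mapφ _ i).trans ?_
    refine (congrArg D.φ (ghost_exp r hi)).trans ((ghost_exp (D.φ r) hi).trans ?_).symm
    rw [← Function.iterate_succ_apply, Function.iterate_succ_apply']

theorem frob_exp {N M : ℕ} (h : N = M + 1) (r : R) : frob h (exp D N r) = exp D M (D.φ r) :=
  ghost_ext (torsionFree_self D) fun i hi => by
    refine (ghost_frobFun _ hi).trans ((ghost_exp r (by omega)).trans ?_)
    exact (ghost_exp (D.φ r) hi).symm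

end TruncWitt
end Witt
section Shifted

open TruncWitt

variable {R : Type u} [CommRing R] (D : FrobeniusLift R)

/-- The pairs `(r, x)` in `W_m(R) × W_(m+n)(B)` with the same image in `W_m(B)`. -/
noncomputable def shiftedSubring (m n : ℕ) (B : Type w) [CommRing B] [Algebra R B] :
    Subring (TruncWitt D m R × TruncWitt D (m + n) B) :=
  RingHom.eqLocus ((map (Algebra.ofId R B)).comp (RingHom.fst _ _))
    ((trunc (Nat.le_add_right m n)).comp (RingHom.snd _ _))

/-- The `m`-shifted Witt vectors `W_[m]n(B) = W_m(R) ×_{W_m(B)} W_(m+n)(B)`. -/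
abbrev ShiftedWitt (m n : ℕ) (B : Type w) [CommRing B] [Algebra R B] : Type (max u w) :=
  shiftedSubring D m n B

variable {D}

namespace ShiftedWitt

variable {m n : ℕ} {B : Type w} [CommRing B] [Algebra R B] {B' : Type w'} [CommRing B'] [Algebra R B']

theorem seq_eq (x : ShiftedWitt D m n B) {j : ℕ} (hj : j ≤ m) :
    x.1.2.seq j = algebraMap R B (x.1.1.seq j) := by
  have h := congrArg (fun y => TruncWitt.seq y j) x.2
  have h1 : (truncFun (M := m) x.1.2).seq j = x.1.2.seq j := seq_ofSeq _ hj
  exact h1.symm.trans (h.symm.trans (seq_mapFun' (Algebra.ofId R B) x.1.1 j))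

theorem mem_of_seq {r : TruncWitt D m R} {x : TruncWitt D (m + n) B}
    (h : ∀ j ≤ m, x.seq j = algebraMap R B (r.seq j)) : (r, x) ∈ shiftedSubring D m n B :=
  ext_seq fun j hj => (seq_mapFun' (Algebra.ofId R B) r j).trans
    ((h j hj).symm.trans (seq_ofSeq (D := D) x.seq hj).symm)

/-- Functoriality of shifted Witt vectors. -/
noncomputable def map (f : B →ₐ[R] B') : ShiftedWitt D m n B →+* ShiftedWitt D m n B' :=
  (((RingHom.fst _ _).prod ((TruncWitt.map f).comp (RingHom.snd _ _))).comp
    (shiftedSubring D m n B).subtype).codRestrict (shiftedSubring D m n B') fun x =>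
      mem_of_seq fun j hj => (seq_mapFun' f x.1.2 j).trans (by rw [seq_eq x hj]; simp)

theorem map_pres_surjective :
    Function.Surjective (map (D := D) (m := m) (n := n) (pres R B)) := by
  intro x
  let s : ℕ → MvPolynomial B R := fun i =>
    if i ≤ m then MvPolynomial.C (x.1.1.seq i) else MvPolynomial.X (x.1.2.seq i)
  refine ⟨⟨(x.1.1, ofSeq D _ s), mem_of_seq fun j hj => ?_⟩, Subtype.ext (Prod.ext rfl ?_)⟩
  · rw [seq_ofSeq _ (by omega), MvPolynomial.algebraMap_eq]
    exact if_pos hj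
  · refine ext_seq fun i hi => (seq_mapFun' (pres R B) (ofSeq D (m + n) s) i).trans ?_
    rw [seq_ofSeq _ hi]
    by_cases h : i ≤ m
    · simp [s, h, pres, seq_eq x h]
    · simp [s, h, pres]

variable (D m n B) in
/-- The projection `W_[m]n(B) ⟶ W_m(R)`. -/
noncomputable def fst : ShiftedWitt D m n B →+* TruncWitt D m R :=
  (RingHom.fst _ _).comp (shiftedSubring D m n B).subtype

variable (D m n B) in
/-- The structure map `R ⟶ W_[m]n(B^(φ^i))`, that is, `r ↦ (exp_δ (φ^i r), exp_δ (φ^i r))`.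
Here `B^(φ^i)` stands for the `R`-algebra map `R ⟶ B` with the `R`-algebra structures of both
rings precomposed with `φ^i`; this leaves the ring `W_[m]n(B)` as it is. -/
noncomputable def str (i : ℕ) : R →+* ShiftedWitt D m n B :=
  (((exp D m).prod ((TruncWitt.map (Algebra.ofId R B)).comp (exp D (m + n)))).comp
    (D.φ ^ i)).codRestrict (shiftedSubring D m n B) fun r => mem_of_seq fun j hj => by
      refine (seq_mapFun' (Algebra.ofId R B) (exp D (m + n) ((D.φ ^ i) r)) j).trans ?_
      exact congrArg (algebraMap R B) ((seq_ofSeq (D := D) _ (by omega)).trans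
        (seq_ofSeq (D := D) _ hj).symm)

/-- The ring homomorphism `E_[m+1] : W_[m+1]n(B) ⟶ W_[m]n(B^φ)`, `(r, x) ↦ (F r, F x)`. -/
noncomputable def E : ShiftedWitt D (m + 1) n B →+* ShiftedWitt D m n B :=
  ((((frob rfl).comp (RingHom.fst _ _)).prod ((frob (Nat.succ_add m n)).comp
    (RingHom.snd _ _))).comp (shiftedSubring D (m + 1) n B).subtype).codRestrict
      (shiftedSubring D m n B) fun x => by
    have h : mapFun (Algebra.ofId R B) (frobFun (M := m) x.1.1) =
        truncFun (frobFun (M := m + n) x.1.2) := by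
      have h1 : mapFun (Algebra.ofId R B) x.1.1 = truncFun x.1.2 := x.2
      rw [mapFun_frobFun, h1]
      obtain ⟨y, hy⟩ := mapFun_pres_surjective (R := R) x.1.2
      rw [← hy]
      simp only [← mapFun_frobFun, ← mapFun_truncFun]
      refine congrArg (mapFun (pres R B))
        (ghost_ext (torsionFree_mvPolynomial D B) fun i hi => ?_)
      rw [ghost_frobFun _ hi, ghost_truncFun _ (by omega), ghost_truncFun _ hi,
        ghost_frobFun _ (by omega)]
    exact h

/-- The sequence of a Witt vector over `R` continued by variables. -/
noncomputable def latGen (r : TruncWitt D m R) (j : ℕ) : MvPolynomial ℕ R :=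
  if j ≤ m then MvPolynomial.C (r.seq j) else MvPolynomial.X j

/-- Given `r` in `W_m(R)`, the coordinates of the lateral Frobenius as polynomials in the other
coordinates: if `z` are the ghost components of the generic point over `r`, they are the unique
polynomials with ghost components `φ z_0, ..., φ z_m, z_(m+2), z_(m+3), ...`. -/
noncomputable def latPoly (r : TruncWitt D m R) : ℕ → MvPolynomial ℕ R :=
  (polyFrob_dvd_lat D (latGen r) m).choose

theorem aeval_latGen (x : ShiftedWitt D m n B) (j : ℕ) :
    MvPolynomial.aeval x.1.2.seq (latGen x.1.1 j) = x.1.2.seq j := by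
  unfold latGen
  split_ifs with h
  · simp [seq_eq x h]
  · simp

theorem gh_latPoly_of_le (r : TruncWitt D m R) {i : ℕ} (h : i ≤ m) :
    gh D (latPoly r) i = MvPolynomial.C (D.φ (r.ghost i)) := by
  refine ((polyFrob_dvd_lat D (latGen r) m).choose_spec i).trans ?_
  rw [if_pos h]
  have : gh D (latGen r) i = MvPolynomial.C (r.ghost i) := by
    rw [ghost, gh_map MvPolynomial.C (by rw [MvPolynomial.algebraMap_eq]; rfl)]
    exact gh_congr fun j hj => if_pos (hj.trans h)
  rw [this]; simp [polyFrob]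

theorem latPoly_of_le (r : TruncWitt D m R) {i : ℕ} (h : i ≤ m) :
    latPoly r i = MvPolynomial.C (D.φ (r.seq i)) := by
  refine gh_inj (torsionFree_mvPolynomial D ℕ) (N := m) (x := latPoly r)
    (y := fun i => MvPolynomial.C (D.φ (r.seq i))) (fun j hj => ?_) i h
  rw [gh_latPoly_of_le r hj, ghost, gh_map D.φ (by simp [D.φ_π]),
    gh_map MvPolynomial.C (by rw [MvPolynomial.algebraMap_eq]; rfl)]

/-- The coordinates of the lateral Frobenius in `W_(m+n)(B)`. -/
noncomputable def latFun (r : TruncWitt D m R) (x : TruncWitt D (m + (n + 1)) B) :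
    TruncWitt D (m + n) B :=
  ofSeq D _ fun i => MvPolynomial.aeval x.seq (latPoly r i)

/-- The defining property of the lateral Frobenius on ghost components:
`⟨z_0, ..., z_(m+n+1)⟩ ↦ ⟨φ z_0, ..., φ z_m, z_(m+2), ..., z_(m+n+1)⟩`. -/
theorem ghost_latFun (x : ShiftedWitt D m (n + 1) B) {i : ℕ} (hi : i ≤ m + n) :
    (latFun (n := n) x.1.1 x.1.2).ghost i =
      if i ≤ m then algebraMap R B (D.φ (x.1.1.ghost i)) else x.1.2.ghost (i + 1) := by
  refine (ghost_ofSeq _ hi).trans ?_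
  have e := congrArg (MvPolynomial.aeval x.1.2.seq)
    ((polyFrob_dvd_lat D (latGen x.1.1) m).choose_spec i)
  rw [gh_map_alg] at e
  refine e.trans ?_
  by_cases h : i ≤ m
  · rw [if_pos h, if_pos h]
    have e2 := (polyFrob_dvd_lat D (latGen x.1.1) m).choose_spec i
    rw [if_pos h] at e2
    rw [← e2]
    exact (congrArg (MvPolynomial.aeval x.1.2.seq) (gh_latPoly_of_le x.1.1 h)).trans
      (MvPolynomial.aeval_C _ _)
  · rw [if_neg h, if_neg h, gh_map_alg]
    exact gh_congr fun j _ => aeval_latGen x j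

theorem mapFun_latFun (f : B →ₐ[R] B') (r : TruncWitt D m R) (x : TruncWitt D (m + (n + 1)) B) :
    mapFun f (latFun (n := n) r x) = latFun r (mapFun f x) :=
  ext_seq fun i hi => by
    rw [seq_mapFun', latFun, latFun, seq_ofSeq _ hi, seq_ofSeq _ hi,
      MvPolynomial.comp_aeval_apply]
    exact congrArg (fun v => MvPolynomial.aeval v (latPoly r i))
      (funext fun s => (seq_mapFun' f x s).symm)

/-- The lateral Frobenius as a map of sets. -/
noncomputable def latElt (x : ShiftedWitt D m (n + 1) B) : ShiftedWitt D m n B :=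
  ⟨(mapφ x.1.1, latFun x.1.1 x.1.2), mem_of_seq fun j hj => by
    rw [latFun, seq_ofSeq _ (by omega), latPoly_of_le _ hj, MvPolynomial.aeval_C]
    exact congrArg (algebraMap R B) (seq_mapFun D.φ x.1.1 j).symm⟩

theorem map_latElt (f : B →ₐ[R] B') (x : ShiftedWitt D m (n + 1) B) :
    map f (latElt x) = latElt (map f x) :=
  Subtype.ext (Prod.ext rfl (mapFun_latFun f x.1.1 x.1.2))

theorem ext_ghost (hB : TorsionFree D B) {x y : ShiftedWitt D m n B} (h1 : x.1.1 = y.1.1)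
    (h : ∀ i ≤ m + n, x.1.2.ghost i = y.1.2.ghost i) : x = y :=
  Subtype.ext (Prod.ext h1 (ghost_ext hB h))

theorem latElt_one : latElt (1 : ShiftedWitt D m (n + 1) B) = 1 := by
  rw [← map_one (map (pres R B)), ← map_latElt, ← map_one (map (pres R B))]
  refine congrArg (map (pres R B)) (ext_ghost (torsionFree_mvPolynomial D B)
    (map_one mapφ) fun i hi => (ghost_latFun _ hi).trans ?_)
  have h1 : ((1 : ShiftedWitt D m (n + 1) (MvPolynomial B R)).1.2).ghost (i + 1) = 1 :=
    ghost_one (by omega)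
  have h2 : ((1 : ShiftedWitt D m n (MvPolynomial B R)).1.2).ghost i = 1 := ghost_one hi
  rw [h1, h2]
  split_ifs with h
  · have h3 : ((1 : ShiftedWitt D m (n + 1) (MvPolynomial B R)).1.1).ghost i = 1 := ghost_one h
    rw [h3, map_one, map_one]
  · rfl

theorem latElt_zero : latElt (0 : ShiftedWitt D m (n + 1) B) = 0 := by
  rw [← map_zero (map (pres R B)), ← map_latElt, ← map_zero (map (pres R B))]
  refine congrArg (map (pres R B)) (ext_ghost (torsionFree_mvPolynomial D B)
    (map_zero mapφ) fun i hi => (ghost_latFun _ hi).trans ?_)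
  have h1 : ((0 : ShiftedWitt D m (n + 1) (MvPolynomial B R)).1.2).ghost (i + 1) = 0 :=
    ghost_zero (by omega)
  have h2 : ((0 : ShiftedWitt D m n (MvPolynomial B R)).1.2).ghost i = 0 := ghost_zero hi
  rw [h1, h2]
  split_ifs with h
  · have h3 : ((0 : ShiftedWitt D m (n + 1) (MvPolynomial B R)).1.1).ghost i = 0 := ghost_zero h
    rw [h3, map_zero, map_zero]
  · rfl

theorem latElt_add (x y : ShiftedWitt D m (n + 1) B) :
    latElt (x + y) = latElt x + latElt y := by
  obtain ⟨x, rfl⟩ := map_pres_surjective x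
  obtain ⟨y, rfl⟩ := map_pres_surjective y
  simp only [← map_latElt, ← map_add]
  refine congrArg (map (pres R B)) (ext_ghost (torsionFree_mvPolynomial D B)
    (map_add mapφ _ _) fun i hi => (ghost_latFun _ hi).trans ?_)
  refine Eq.trans ?_ (ghost_add (latFun x.1.1 x.1.2) (latFun y.1.1 y.1.2) hi).symm
  rw [ghost_latFun x hi, ghost_latFun y hi]
  have h1 : ((x + y).1.2).ghost (i + 1) = x.1.2.ghost (i + 1) + y.1.2.ghost (i + 1) :=
    ghost_add _ _ (by omega)
  rw [h1]
  split_ifs with h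
  · have h3 : ((x + y).1.1).ghost i = x.1.1.ghost i + y.1.1.ghost i := ghost_add _ _ h
    rw [h3, map_add, map_add]
  · rfl

theorem latElt_mul (x y : ShiftedWitt D m (n + 1) B) :
    latElt (x * y) = latElt x * latElt y := by
  obtain ⟨x, rfl⟩ := map_pres_surjective x
  obtain ⟨y, rfl⟩ := map_pres_surjective y
  simp only [← map_latElt, ← map_mul]
  refine congrArg (map (pres R B)) (ext_ghost (torsionFree_mvPolynomial D B)
    (map_mul mapφ _ _) fun i hi => (ghost_latFun _ hi).trans ?_)
  refine Eq.trans ?_ (ghost_mul (latFun x.1.1 x.1.2) (latFun y.1.1 y.1.2) hi).symm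
  rw [ghost_latFun x hi, ghost_latFun y hi]
  have h1 : ((x * y).1.2).ghost (i + 1) = x.1.2.ghost (i + 1) * y.1.2.ghost (i + 1) :=
    ghost_mul _ _ (by omega)
  rw [h1]
  split_ifs with h
  · have h3 : ((x * y).1.1).ghost i = x.1.1.ghost i * y.1.1.ghost i := ghost_mul _ _ h
    rw [h3, map_mul, map_mul]
  · rfl

/-- The lateral Frobenius `F_[m] : W_[m](n+1)(B) ⟶ W_[m]n(B^φ)` as a ring homomorphism. -/
noncomputable def lat : ShiftedWitt D m (n + 1) B →+* ShiftedWitt D m n B where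
  toFun := latElt
  map_one' := latElt_one
  map_zero' := latElt_zero
  map_add' := latElt_add
  map_mul' := latElt_mul

theorem map_comp_str (f : B →ₐ[R] B') (i : ℕ) :
    (map (D := D) (m := m) (n := n) f).comp (str D m n B i) = str D m n B' i := by
  refine RingHom.ext fun r => Subtype.ext (Prod.ext rfl (ext_seq fun j hj => ?_))
  refine (seq_mapFun' f _ j).trans ?_
  refine (congrArg f (seq_mapFun' (Algebra.ofId R B) _ j)).trans ?_
  refine Eq.trans ?_ (seq_mapFun' (Algebra.ofId R B') _ j).symm
  simp [Algebra.ofId_apply]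

theorem fst_comp_map (f : B →ₐ[R] B') :
    (fst D m n B').comp (map f) = fst D m n B := rfl

theorem fst_comp_E : (fst D m n B).comp E = (frob rfl).comp (fst D (m + 1) n B) := rfl

theorem fst_comp_lat : (fst D m n B).comp lat = mapφ.comp (fst D m (n + 1) B) := rfl

theorem map_comp_E (f : B →ₐ[R] B') :
    (map f).comp (E (D := D) (m := m) (n := n)) = E.comp (map f) :=
  RingHom.ext fun x => Subtype.ext (Prod.ext rfl (mapFun_frobFun f x.1.2))

theorem map_comp_lat (f : B →ₐ[R] B') :
    (map f).comp (lat (D := D) (m := m) (n := n)) = lat.comp (map f) :=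
  RingHom.ext fun x => map_latElt f x

theorem φ_pow_succ (i : ℕ) (r : R) : (D.φ ^ (i + 1)) r = D.φ ((D.φ ^ i) r) := by
  rw [pow_succ']; rfl

theorem E_comp_str (i : ℕ) :
    (E (n := n)).comp (str D (m + 1) n B i) = str D m n B (i + 1) := by
  refine RingHom.ext fun r => Subtype.ext (Prod.ext ?_ ?_)
  · refine (frob_exp rfl ((D.φ ^ i) r)).trans ?_
    rw [← φ_pow_succ]; rfl
  · refine (mapFun_frobFun (Algebra.ofId R B) (exp D (m + 1 + n) ((D.φ ^ i) r))).symm.trans ?_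
    refine congrArg (mapFun (Algebra.ofId R B)) ?_
    refine (frob_exp (Nat.succ_add m n) ((D.φ ^ i) r)).trans ?_
    rw [← φ_pow_succ]

theorem lat_comp_str (i : ℕ) :
    (lat (n := n)).comp (str D m (n + 1) B i) = str D m n B (i + 1) := by
  have key : (lat (n := n)).comp (str D m (n + 1) R i) = str D m n R (i + 1) := by
    refine RingHom.ext fun r => ext_ghost (torsionFree_self D) ?_ fun j hj => ?_
    · refine (mapφ_exp ((D.φ ^ i) r)).trans ?_
      rw [← φ_pow_succ]; rfl
    · have hid : ∀ N (y : TruncWitt D N R), mapFun (Algebra.ofId R R) y = y := fun N y => rfl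
      have hstr : ∀ (a b : ℕ) {k : ℕ}, k ≤ a + b →
          ((str D a b R i r).1.2).ghost k = D.φ^[k] ((D.φ ^ i) r) := fun a b k hk =>
        (congrArg (fun z => ghost z k) (hid _ _)).trans (ghost_exp _ hk)
      have hstr1 : ((str D m n R (i + 1) r).1.2).ghost j = D.φ^[j] ((D.φ ^ (i + 1)) r) :=
        (congrArg (fun z => ghost z j) (hid _ _)).trans (ghost_exp _ hj)
      rw [hstr1]
      refine (ghost_latFun _ hj).trans ?_
      rw [hstr _ _ (by omega), φ_pow_succ, ← Function.iterate_succ_apply]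
      split_ifs with h
      · have : ((str D m (n + 1) R i r).1.1).ghost j = D.φ^[j] ((D.φ ^ i) r) := ghost_exp _ h
        rw [this, Function.iterate_succ_apply']; rfl
      · rfl
  rw [← map_comp_str (Algebra.ofId R B), ← map_comp_str (Algebra.ofId R B), ← key,
    ← RingHom.comp_assoc, ← RingHom.comp_assoc, map_comp_lat]

end ShiftedWitt
end Shifted
section FormalSchemes

/-- The tower `Spec (A / I) ⟶ Spec (A / I ^ 2) ⟶ ...` of locally ringed spaces. -/
noncomputable def spfTower (A : Type u) [CommRing A] (I : Ideal A) : ℕ ⥤ LocallyRingedSpace.{u} where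
  obj n := Spec.locallyRingedSpaceObj (CommRingCat.of (A ⧸ I ^ (n + 1)))
  map {n k} h := Spec.locallyRingedSpaceMap (CommRingCat.ofHom
    (Ideal.Quotient.factor (Ideal.pow_le_pow_right (Nat.succ_le_succ (leOfHom h)))))
  map_id n := by
    rw [← Spec.locallyRingedSpaceMap_id]
    congr 1
    ext x
    rfl
  map_comp f g := by
    rw [← Spec.locallyRingedSpaceMap_comp]
    congr 1
    ext x
    rfl

/-- The formal spectrum of `A` with the `I`-adic topology, as the colimit of the spectra of the
`A / I ^ (n + 1)` in locally ringed spaces. -/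
noncomputable def Spf (A : Type u) [CommRing A] (I : Ideal A) : LocallyRingedSpace.{u} :=
  colimit (spfTower A I)

namespace Spf

variable {A : Type u} [CommRing A] {I : Ideal A} {B : Type u} [CommRing B] {J : Ideal B}
  {C : Type u} [CommRing C] {K : Ideal C}

theorem pow_le_comap (f : A →+* B) (h : I.map f ≤ J) (n : ℕ) : I ^ n ≤ (J ^ n).comap f := by
  rw [← Ideal.map_le_iff_le_comap, Ideal.map_pow]
  exact Ideal.pow_right_mono h n

theorem colimMap_comp' {F G H : ℕ ⥤ LocallyRingedSpace.{u}} (α : F ⟶ G) (β : G ⟶ H) :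
    colimMap α ≫ colimMap β = colimMap (α ≫ β) := by
  refine colimit.hom_ext fun n => ?_
  simp

theorem colimMap_id' (F : ℕ ⥤ LocallyRingedSpace.{u}) : colimMap (𝟙 F) = 𝟙 (colimit F) := by
  refine colimit.hom_ext fun n => ?_
  simp

/-- The map of towers induced by a ring homomorphism. -/
noncomputable def towerMap (f : A →+* B) (h : I.map f ≤ J) : spfTower B J ⟶ spfTower A I where
  app n := Spec.locallyRingedSpaceMap (CommRingCat.ofHom
    (Ideal.quotientMap (J ^ (n + 1)) f (pow_le_comap f h (n + 1))))
  naturality n k g := by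
    refine (Spec.locallyRingedSpaceMap_comp _ _).symm.trans
      (Eq.trans ?_ (Spec.locallyRingedSpaceMap_comp _ _))
    congr 1
    ext x
    rfl

/-- Functoriality of the formal spectrum. -/
noncomputable def map (f : A →+* B) (h : I.map f ≤ J) : Spf B J ⟶ Spf A I :=
  colimMap (towerMap f h)

theorem map_comp (f : A →+* B) (h : I.map f ≤ J) (g : B →+* C) (h' : J.map g ≤ K)
    (h'' : I.map (g.comp f) ≤ K) :
    map g h' ≫ map f h = map (g.comp f) h'' := by
  have e : towerMap g h' ≫ towerMap f h = towerMap (g.comp f) h'' := by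
    refine NatTrans.ext (funext fun n => ?_)
    refine (Spec.locallyRingedSpaceMap_comp _ _).symm.trans ?_
    refine congrArg (fun z => Spec.locallyRingedSpaceMap z) ?_
    ext x
    rfl
  exact (colimMap_comp' _ _).trans (congrArg colimMap e)

theorem map_id (h : I.map (RingHom.id A) ≤ I) : map (RingHom.id A) h = 𝟙 (Spf A I) := by
  have e : towerMap (RingHom.id A) h = 𝟙 (spfTower A I) := by
    refine NatTrans.ext (funext fun n => ?_)
    refine Eq.trans ?_ (Spec.locallyRingedSpaceMap_id _)
    refine congrArg (fun z => Spec.locallyRingedSpaceMap z) ?_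
    ext x
    rfl
  exact (congrArg colimMap e).trans (colimMap_id' _)

theorem map_congr {f g : A →+* B} (e : f = g) (h : I.map f ≤ J) (h' : I.map g ≤ J) :
    map f h = map g h' := by
  subst e; rfl

/-- From a commuting square of rings. -/
theorem map_comp_eq {C' : Type u} [CommRing C'] {K' : Ideal C'} (f : A →+* B) (h : I.map f ≤ J)
    (g : B →+* C) (h' : J.map g ≤ K) (k : A →+* C') (hk : I.map k ≤ K') (l : C' →+* C)
    (hl : K'.map l ≤ K) (e : g.comp f = l.comp k) :
    map g h' ≫ map f h = map l hl ≫ map k hk := by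
  have h1 : I.map (g.comp f) ≤ K := by
    rw [← Ideal.map_map]; exact (Ideal.map_mono h).trans h'
  rw [map_comp f h g h' h1, map_comp k hk l hl (by rw [← e]; exact h1)]
  exact map_congr e _ _

end Spf

/-- A `ϖ`-formal scheme over `Spf R`: a locally ringed space over `Spf R` that is covered by open
subspaces isomorphic over `Spf R` to `Spf A` with `A` a `ϖ`-adically complete `R`-algebra. (All
topologies being `ϖ`-adic, morphisms of locally ringed spaces over `Spf R` are automatically
continuous on sections.) -/
structure FormalScheme (R : Type u) [CommRing R] (ϖ : R) where
  toLRS : LocallyRingedSpace.{u}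
  str : toLRS ⟶ Spf R (Ideal.span {ϖ})
  locally_affine : ∀ x : toLRS, ∃ (A : Type u) (_ : CommRing A) (_ : Algebra R A)
    (_ : IsAdicComplete (Ideal.span {ϖ}) A)
    (j : Spf A ((Ideal.span {ϖ}).map (algebraMap R A)) ⟶ toLRS),
    LocallyRingedSpace.IsOpenImmersion j ∧ x ∈ Set.range j.base ∧
      j ≫ str = Spf.map (algebraMap R A) le_rfl

end FormalSchemes

section Kernel

variable {R : Type u} [CommRing R] (D : FrobeniusLift R)

/-- The category of `π`-adically complete `R`-algebras. -/
abbrev CompleteAlg : Type (u + 1) :=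
  ObjectProperty.FullSubcategory
    (fun B : CommAlgCat.{u} R => IsAdicComplete (Ideal.span {D.π}) B)

variable {D}

/-- The ideal of `W_[m]n(B^(φ^i))` generated by `π`. -/
noncomputable abbrev wittIdeal (m n i : ℕ) (B : Type u) [CommRing B] [Algebra R B] :
    Ideal (ShiftedWitt D m n B) := (Ideal.span {D.π}).map (ShiftedWitt.str D m n B i)

/-- The structure map `R ⟶ W_m(R^(φ^i))`. -/
noncomputable abbrev expTwist (D : FrobeniusLift R) (m i : ℕ) : R →+* TruncWitt D m R :=
  (TruncWitt.exp D m).comp (D.φ ^ i)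

/-- The point `P^m` of the `m`-th jet space with values in `R^(φ^i)`: the composite of
`Spf W_m(R^(φ^i)) ⟶ Spf R` induced by `exp_δ` with the marked point `P`. -/
noncomputable def markedPoint {X : FormalScheme R D.π} (P : Spf R (Ideal.span {D.π}) ⟶ X.toLRS)
    (m i : ℕ) : Spf (TruncWitt D m R) ((Ideal.span {D.π}).map (expTwist D m i)) ⟶ X.toLRS :=
  Spf.map (expTwist D m i) le_rfl ≫ P

theorem fst_ideal (m n i : ℕ) (B : Type u) [CommRing B] [Algebra R B] :
    (wittIdeal (D := D) m n i B).map (ShiftedWitt.fst D m n B) ≤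
      (Ideal.span {D.π}).map (expTwist D m i) := by
  rw [Ideal.map_map]; exact le_rfl

/-- The closed immersion `i_m : Spf W_m(R^(φ^i)) ⟶ Spf W_[m]n(B^(φ^i))`. -/
noncomputable def kernelInclusion (m n i : ℕ) (B : Type u) [CommRing B] [Algebra R B] :
    Spf (TruncWitt D m R) ((Ideal.span {D.π}).map (expTwist D m i)) ⟶
      Spf (ShiftedWitt D m n B) (wittIdeal m n i B) :=
  Spf.map (ShiftedWitt.fst D m n B) (fst_ideal m n i B)

variable (X : FormalScheme R D.π) (P : Spf R (Ideal.span {D.π}) ⟶ X.toLRS)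

/-- The points of `N^[m]n X` with values in `B^(φ^i)`: morphisms `Spf W_[m]n(B^(φ^i)) ⟶ X` over
`Spf R` that restrict to `P^m` along `i_m`. -/
@[ext]
structure KernelPoint (m n i : ℕ) (B : Type u) [CommRing B] [Algebra R B] : Type u where
  hom : Spf (ShiftedWitt D m n B) (wittIdeal m n i B) ⟶ X.toLRS
  isOver : hom ≫ X.str = Spf.map (ShiftedWitt.str D m n B i) le_rfl
  marked : kernelInclusion m n i B ≫ hom = markedPoint P m i

variable {X P}
variable {m n i : ℕ} {B : Type u} [CommRing B] [Algebra R B] {B' : Type u} [CommRing B']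
  [Algebra R B']

theorem map_ideal (f : B →ₐ[R] B') :
    (wittIdeal (D := D) m n i B).map (ShiftedWitt.map f) ≤ wittIdeal m n i B' := by
  rw [Ideal.map_map, ShiftedWitt.map_comp_str]

theorem E_ideal : (wittIdeal (D := D) (m + 1) n i B).map ShiftedWitt.E ≤
    wittIdeal m n (i + 1) B := by
  rw [Ideal.map_map, ShiftedWitt.E_comp_str]

theorem lat_ideal : (wittIdeal (D := D) m (n + 1) i B).map ShiftedWitt.lat ≤
    wittIdeal m n (i + 1) B := by
  rw [Ideal.map_map, ShiftedWitt.lat_comp_str]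

theorem frob_comp_expTwist (m i : ℕ) :
    (TruncWitt.frob rfl).comp (expTwist D (m + 1) i) = expTwist D m (i + 1) :=
  RingHom.ext fun r => (TruncWitt.frob_exp rfl ((D.φ ^ i) r)).trans
    (by rw [← ShiftedWitt.φ_pow_succ]; rfl)

theorem mapφ_comp_expTwist (m i : ℕ) :
    TruncWitt.mapφ.comp (expTwist D m i) = expTwist D m (i + 1) :=
  RingHom.ext fun r => (TruncWitt.mapφ_exp ((D.φ ^ i) r)).trans
    (by rw [← ShiftedWitt.φ_pow_succ]; rfl)

/-- Precomposition of points with a ring homomorphism. -/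
noncomputable def KernelPoint.precomp {m' n' i' : ℕ} (g : KernelPoint X P m n i B)
    (f : ShiftedWitt D m n B →+* ShiftedWitt D m' n' B')
    (k : TruncWitt D m R →+* TruncWitt D m' R)
    (hf : f.comp (ShiftedWitt.str D m n B i) = ShiftedWitt.str D m' n' B' i')
    (hk : k.comp (expTwist D m i) = expTwist D m' i')
    (hfk : (ShiftedWitt.fst D m' n' B').comp f = k.comp (ShiftedWitt.fst D m n B)) :
    KernelPoint X P m' n' i' B' where
  hom := Spf.map f (by rw [Ideal.map_map, hf]) ≫ g.hom
  isOver := by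
    rw [Category.assoc, g.isOver, Spf.map_comp _ _ _ _ (by rw [hf])]
    exact Spf.map_congr hf _ _
  marked := by
    unfold kernelInclusion
    rw [← Category.assoc, Spf.map_comp_eq _ _ _ _ (ShiftedWitt.fst D m n B) (fst_ideal m n i B) k
      (by rw [Ideal.map_map, hk]) hfk, Category.assoc]
    have h := g.marked
    unfold kernelInclusion at h
    rw [h]
    unfold markedPoint
    rw [← Category.assoc, Spf.map_comp _ _ _ _ (by rw [hk])]
    exact congrArg (· ≫ P) (Spf.map_congr hk _ _)

variable (X P)

namespace KernelPoint

variable {X P}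

theorem precomp_precomp {m' n' i' m'' n'' i'' : ℕ} {B'' : Type u} [CommRing B'']
    [Algebra R B''] (g : KernelPoint X P m n i B)
    (f : ShiftedWitt D m n B →+* ShiftedWitt D m' n' B')
    (k : TruncWitt D m R →+* TruncWitt D m' R) (hf hk hfk)
    (f' : ShiftedWitt D m' n' B' →+* ShiftedWitt D m'' n'' B'')
    (k' : TruncWitt D m' R →+* TruncWitt D m'' R) (hf' hk' hfk') (h) :
    ((g.precomp (i' := i') f k hf hk hfk).precomp (i' := i'') f' k' hf' hk' hfk').hom =
      Spf.map (f'.comp f) h ≫ g.hom := by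
  unfold KernelPoint.precomp
  dsimp only
  rw [← Category.assoc, Spf.map_comp]

/-- Functoriality in `B`. -/
noncomputable def map (f : B →ₐ[R] B') (g : KernelPoint X P m n i B) : KernelPoint X P m n i B' :=
  g.precomp (ShiftedWitt.map f) (RingHom.id _) (ShiftedWitt.map_comp_str f i) (RingHom.id_comp _)
    (ShiftedWitt.fst_comp_map f)

/-- Composition with the morphism of formal spectra induced by the lateral Frobenius `F_[m]`. -/
noncomputable def lateral (g : KernelPoint X P m (n + 1) i B) : KernelPoint X P m n (i + 1) B :=
  g.precomp ShiftedWitt.lat TruncWitt.mapφ (ShiftedWitt.lat_comp_str i) (mapφ_comp_expTwist m i)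
    ShiftedWitt.fst_comp_lat

/-- Composition with the morphism of formal spectra induced by `E_[m+1]`. -/
noncomputable def phi (g : KernelPoint X P (m + 1) n i B) : KernelPoint X P m n (i + 1) B :=
  g.precomp ShiftedWitt.E (TruncWitt.frob rfl) (ShiftedWitt.E_comp_str i) (frob_comp_expTwist m i)
    ShiftedWitt.fst_comp_E

theorem map_id (g : KernelPoint X P m n i B) : g.map (AlgHom.id R B) = g := by
  refine KernelPoint.ext ((congrArg (· ≫ g.hom) ?_).trans (Category.id_comp g.hom))
  have e : ShiftedWitt.map (D := D) (m := m) (n := n) (AlgHom.id R B) = RingHom.id _ := rfl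
  exact (Spf.map_congr e _ (Ideal.map_id _).le).trans (Spf.map_id _)

theorem map_map {B'' : Type u} [CommRing B''] [Algebra R B''] (f : B →ₐ[R] B')
    (f' : B' →ₐ[R] B'') (g : KernelPoint X P m n i B) :
    (g.map f).map f' = g.map (f'.comp f) := by
  have e : (ShiftedWitt.map (D := D) (m := m) (n := n) f').comp (ShiftedWitt.map f) =
    ShiftedWitt.map (f'.comp f) := rfl
  refine KernelPoint.ext ((precomp_precomp g _ _ _ _ _ _ _ _ _ _ ?_).trans
    (congrArg (· ≫ g.hom) (Spf.map_congr e _ _)))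
  rw [e]; exact map_ideal _

theorem lateral_map (f : B →ₐ[R] B') (g : KernelPoint X P m (n + 1) i B) :
    (g.map f).lateral = g.lateral.map f := by
  have h : (wittIdeal m (n + 1) i B).map
      ((ShiftedWitt.map f).comp (ShiftedWitt.lat (D := D) (m := m) (n := n))) ≤
      wittIdeal m n (i + 1) B' := by
    rw [← Ideal.map_map]; exact (Ideal.map_mono lat_ideal).trans (map_ideal f)
  refine KernelPoint.ext ((precomp_precomp g _ _ _ _ _ _ _ _ _ _ ?_).trans
    ((congrArg (· ≫ g.hom) (Spf.map_congr (ShiftedWitt.map_comp_lat f).symm _ h)).trans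
      (precomp_precomp g _ _ _ _ _ _ _ _ _ _ h).symm))
  rw [← ShiftedWitt.map_comp_lat]; exact h

theorem phi_map (f : B →ₐ[R] B') (g : KernelPoint X P (m + 1) n i B) :
    (g.map f).phi = g.phi.map f := by
  have h : (wittIdeal (m + 1) n i B).map
      ((ShiftedWitt.map f).comp (ShiftedWitt.E (D := D) (m := m) (n := n))) ≤
      wittIdeal m n (i + 1) B' := by
    rw [← Ideal.map_map]; exact (Ideal.map_mono E_ideal).trans (map_ideal f)
  refine KernelPoint.ext ((precomp_precomp g _ _ _ _ _ _ _ _ _ _ ?_).trans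
    ((congrArg (· ≫ g.hom) (Spf.map_congr (ShiftedWitt.map_comp_E f).symm _ h)).trans
      (precomp_precomp g _ _ _ _ _ _ _ _ _ _ h).symm))
  rw [← ShiftedWitt.map_comp_E]; exact h

end KernelPoint

/-- The functor of points `B ↦ N^[m]n X(B^(φ^i))` on `π`-adically complete `R`-algebras; for `i = 0`
it is the functor of points of `N^[m]n X`. -/
noncomputable def kernelFunctor (m n i : ℕ) : CompleteAlg D ⥤ Type u where
  obj B := KernelPoint X P m n i B.obj
  map f := TypeCat.ofHom fun g => g.map f.hom.hom
  map_id B := ConcreteCategory.hom_ext _ _ fun g => KernelPoint.map_id g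
  map_comp f f' := ConcreteCategory.hom_ext _ _ fun g =>
    (KernelPoint.map_map f.hom.hom f'.hom.hom g).symm

/-- The generalized lateral Frobenius `f_m : N^[m](n+1) X ⟶ N^[m]n X` over `φ`, as a natural
transformation `N^[m](n+1) X(B^(φ^i)) ⟶ N^[m]n X(B^(φ^(i+1)))`. -/
noncomputable def lateralFrobenius (m n i : ℕ) :
    kernelFunctor X P m (n + 1) i ⟶ kernelFunctor X P m n (i + 1) where
  app B := TypeCat.ofHom fun g => g.lateral
  naturality _ _ f := ConcreteCategory.hom_ext _ _ fun g => KernelPoint.lateral_map f.hom.hom g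

/-- The morphism `Φ_[m+1] : N^[m+1]n X ⟶ N^[m]n X` over `φ`, as a natural transformation
`N^[m+1]n X(B^(φ^i)) ⟶ N^[m]n X(B^(φ^(i+1)))`. -/
noncomputable def phiMap (m n i : ℕ) :
    kernelFunctor X P (m + 1) n i ⟶ kernelFunctor X P m n (i + 1) where
  app B := TypeCat.ofHom fun g => g.phi
  naturality _ _ f := ConcreteCategory.hom_ext _ _ fun g => KernelPoint.phi_map f.hom.hom g

end Kernel

end ArithJet

open ArithJet

/-!
The morphisms `Φ_[m+1]` and `f_m` are composition with the morphisms of formal spectra induced by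
the ring homomorphisms `E_[m+1]` and `F_[m]`, so by functoriality of `Spf` the claim reduces to
the identity `F_[m] ∘ E_[m+1] = E_[m+1] ∘ F_[m+1]` of ring homomorphisms
`W_[m+1](n+1)(B) ⟶ W_[m]n(B)` (`ShiftedWitt.lat_comp_E`). On ghost components both sides are
`⟨z_0, ..., z_(m+n+2)⟩ ↦ ⟨φ z_1, ..., φ z_(m+1), z_(m+3), ..., z_(m+n+2)⟩`, which proves the
identity when `B` has no `π`-torsion. The general case follows because all the maps are functorial
in `B` and every `B` is a quotient of a polynomial ring over `R`, which has no `π`-torsion, with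
`W_[m+1](n+1)` preserving the surjection.
-/

namespace ArithJet

variable {R : Type u} [CommRing R] {D : FrobeniusLift R}

theorem TruncWitt.mapφ_frob {N M : ℕ} (h : N = M + 1) (r : TruncWitt D N R) :
    mapφ (frob h r) = frob h (mapφ r) :=
  ghost_ext (torsionFree_self D) fun i hi =>
    (ghost_mapφ _ i).trans ((congrArg D.φ (ghost_frobFun r hi)).trans
      ((ghost_frobFun _ hi).trans (ghost_mapφ r (i + 1))).symm)

namespace ShiftedWitt

variable {m n : ℕ} {B : Type w} [CommRing B] [Algebra R B]

/-- If `B` has no `π`-torsion, the two composites agree because they agree on ghost components. -/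
theorem lat_E_of_torsionFree (hB : TorsionFree D B) (x : ShiftedWitt D (m + 1) (n + 1) B) :
    lat (n := n) (E x) = E (lat x) := by
  refine ext_ghost hB (TruncWitt.mapφ_frob rfl x.1.1) fun i hi => ?_
  refine (ghost_latFun (E x) hi).trans
    (((TruncWitt.ghost_frobFun _ hi).trans (ghost_latFun x (by omega))).trans ?_).symm
  by_cases h : i ≤ m
  · rw [if_pos h, if_pos (by omega)]
    exact congrArg (fun z => algebraMap R B (D.φ z)) (TruncWitt.ghost_frobFun x.1.1 h).symm
  · rw [if_neg h, if_neg (by omega)]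
    exact (TruncWitt.ghost_frobFun x.1.2 (by omega)).symm

/-- The ring homomorphisms `F_[m] ∘ E_[m+1]` and `E_[m+1] ∘ F_[m+1]` agree. -/
theorem lat_comp_E :
    (lat (D := D) (m := m) (n := n) (B := B)).comp E = E.comp lat := by
  refine RingHom.ext fun x => ?_
  obtain ⟨y, rfl⟩ := map_pres_surjective x
  have hE := fun k l => RingHom.congr_fun (map_comp_E (D := D) (m := k) (n := l) (TruncWitt.pres R B))
  have hL := fun k l => RingHom.congr_fun (map_comp_lat (D := D) (m := k) (n := l) (TruncWitt.pres R B))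
  simp only [RingHom.comp_apply] at hE hL ⊢
  rw [← hE, ← hL, ← hL, ← hE, lat_E_of_torsionFree (torsionFree_mvPolynomial D B)]

end ShiftedWitt

theorem KernelPoint.lateral_phi {X : FormalScheme R D.π}
    {P : Spf R (Ideal.span {D.π}) ⟶ X.toLRS} {m n i : ℕ} {B : Type u} [CommRing B] [Algebra R B]
    (g : KernelPoint X P (m + 1) (n + 1) i B) : g.phi.lateral = g.lateral.phi := by
  have h : (wittIdeal (m + 1) (n + 1) i B).map
      ((ShiftedWitt.lat (D := D) (m := m) (n := n)).comp ShiftedWitt.E) ≤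
      wittIdeal m n (i + 1 + 1) B := by
    rw [← Ideal.map_map]; exact (Ideal.map_mono E_ideal).trans lat_ideal
  have h' : (wittIdeal (m + 1) (n + 1) i B).map
      ((ShiftedWitt.E (D := D) (m := m) (n := n)).comp ShiftedWitt.lat) ≤
      wittIdeal m n (i + 1 + 1) B := by
    rw [← Ideal.map_map]; exact (Ideal.map_mono lat_ideal).trans E_ideal
  exact KernelPoint.ext ((precomp_precomp g _ _ _ _ _ _ _ _ _ _ h).trans
    ((congrArg (· ≫ g.hom) (Spf.map_congr ShiftedWitt.lat_comp_E h h')).trans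
      (precomp_precomp g _ _ _ _ _ _ _ _ _ _ h').symm))

end ArithJet

theorem theorem5 {O : Type v} [CommRing O] [IsDedekindDomain O] (𝔭 : Ideal O) [𝔭.IsPrime]
    (h𝔭 : 𝔭 ≠ ⊥) [Finite (O ⧸ 𝔭)] (π : Localization.AtPrime 𝔭)
    (hπ : Ideal.span {π} = IsLocalRing.maximalIdeal (Localization.AtPrime 𝔭))
    {R : Type u} [CommRing R] [IsDomain R] [IsDiscreteValuationRing R]
    [Algebra (Localization.AtPrime 𝔭) R]
    (hπR : algebraMap (Localization.AtPrime 𝔭) R π ≠ 0)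
    (hR : IsAdicComplete (Ideal.span {algebraMap (Localization.AtPrime 𝔭) R π}) R)
    (φ : R →ₐ[Localization.AtPrime 𝔭] R)
    (hφ : ∀ x : R, algebraMap (Localization.AtPrime 𝔭) R π ∣ φ x - x ^ Nat.card (O ⧸ 𝔭))
    (D : FrobeniusLift R) (hD : D = FrobeniusLift.ofDedekind 𝔭 π hπ hπR φ hφ)
    (X : FormalScheme R D.π) (P : Spf R (Ideal.span {D.π}) ⟶ X.toLRS) (hP : P ≫ X.str = 𝟙 _)
    (m n i : ℕ) :
    phiMap X P m (n + 1) i ≫ lateralFrobenius X P m n (i + 1) =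
      lateralFrobenius X P (m + 1) n i ≫ phiMap X P m n (i + 1) := by
  refine NatTrans.ext (funext fun B => ConcreteCategory.hom_ext _ _ fun g => ?_)
  exact KernelPoint.lateral_phi g
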